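/- Let $k$ be a commutative integral domain and let $K$ be an abstract simplicial complex on finitely many vertices $x_1,\dots,x_n$ (the empty set is a face). Let $R=k[x_1,\dots,x_n]/I_K$ be its Stanley-Reisner ring, where $I_K$ is generated by the square-free monomials $\prod_{x_i\in\sigma}x_i$ with $\sigma\notin K$. For a face $\sigma\in K$ put $x_\sigma=\prod_{x_i\in\sigma}x_i\in R$ and let $\mathrm{st}(\sigma)=\{\tau\in K : \tau\cup\sigma\in K\}$ be its closed star. Let $D(R)=\bigcup_{m\ge 0}D^m(R)\subseteq \mathrm{End}_k(R)$ be the ring of $k$-linear differential operators on $R$, where $D^0(R)=R$ acts by multiplication and, for $m>0$, $D^m(R)=\{\varphi\in \mathrm{End}_k(R) : [\varphi,r]\in D^{m-1}(R)\text{ for all } r\in R\}$. (1) If $k$ is a field, then every proper two-sided ideal of $D(R)$ is generated, as a two-sided ideal, by a (possibly empty) set of monomials $x_\sigma$, where each $\sigma$ is a face of $K$ with $\mathrm{st}(\sigma)\neq K$. (2) If $\sigma$ is a face of $K$ with $\mathrm{st}(\sigma)=K$, then the two-sided ideal of $D(R)$ generated by $x_\sigma$ is all of $D(R)$. -/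

import Mathlib

/-- An abstract simplicial complex whose vertices are among the elements of `V`:
a set of finite subsets of `V` (the faces), closed under passing to subsets and containing the
empty face.  Singletons need not be faces, so that every quotient of a polynomial ring by
square-free monomials different from `1` is a face ring. -/
structure SimplicialCpx (V : Type*) where
  faces : Set (Finset V)
  empty_mem : ∅ ∈ faces
  down_closed : ∀ {σ τ : Finset V}, σ ∈ faces → τ ⊆ σ → τ ∈ faces

namespace SimplicialCpx

variable {V : Type*}

/-- The closed star of `σ` in `K`: all faces `τ` of `K` such that `τ ∪ σ` is a face of `K`. -/
def closedStar [DecidableEq V] (K : SimplicialCpx V) (σ : Finset V) : Set (Finset V) :=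
  {τ | τ ∈ K.faces ∧ τ ∪ σ ∈ K.faces}

/-- The face ideal of `K`, generated by the square-free monomials of the non-faces. -/
noncomputable def faceIdeal (k : Type*) [CommRing k] (K : SimplicialCpx V) : Ideal (MvPolynomial V k) :=
  Ideal.span {f | ∃ σ : Finset V, σ ∉ K.faces ∧ f = ∏ i ∈ σ, MvPolynomial.X i}

/-- The Stanley-Reisner ring (face ring) of `K` with coefficients in `k`. -/
abbrev FaceRing (k : Type*) [CommRing k] (K : SimplicialCpx V) : Type _ :=
  MvPolynomial V k ⧸ K.faceIdeal k

/-- The monomial `x_σ`, the product of the variables in `σ`, as an element of the face ring. -/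
noncomputable def faceMonomial (k : Type*) [CommRing k] (K : SimplicialCpx V) (σ : Finset V) :
    K.FaceRing k :=
  Ideal.Quotient.mk (K.faceIdeal k) (∏ i ∈ σ, MvPolynomial.X i)

end SimplicialCpx

namespace DiffOp

variable (k : Type*) [CommRing k] (R : Type*) [CommRing R] [Algebra k R]

/-- `ofOrder k R n` is the `k`-module of `k`-linear differential operators of order at most `n`
on `R`: in order `0` the multiplications by elements of `R`, in order `n + 1` the
`k`-linear endomorphisms `φ` all of whose commutators with multiplications have order at
most `n`. -/
def ofOrder : ℕ → Submodule k (Module.End k R)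
  | 0 => LinearMap.range (Algebra.lmul k R).toLinearMap
  | n + 1 =>
    { carrier := {φ | ∀ r : R,
        φ * Algebra.lmul k R r - Algebra.lmul k R r * φ ∈ ofOrder n}
      zero_mem' := fun r => by simp
      add_mem' := fun {φ ψ} hφ hψ r => by
        have h := (ofOrder n).add_mem (hφ r) (hψ r)
        convert h using 1
        noncomm_ring
      smul_mem' := fun c φ hφ r => by
        have h := (ofOrder n).smul_mem c (hφ r)
        convert h using 1
        rw [smul_sub, smul_mul_assoc, mul_smul_comm] }

variable {k R}

theorem mem_ofOrder_zero {φ : Module.End k R} :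
    φ ∈ ofOrder k R 0 ↔ ∃ r : R, Algebra.lmul k R r = φ := Iff.rfl

theorem mem_ofOrder_succ {n : ℕ} {φ : Module.End k R} :
    φ ∈ ofOrder k R (n + 1) ↔
      ∀ r : R, φ * Algebra.lmul k R r - Algebra.lmul k R r * φ ∈ ofOrder k R n := Iff.rfl

theorem ofOrder_le_succ (n : ℕ) : ofOrder k R n ≤ ofOrder k R (n + 1) := by
  induction n with
  | zero =>
    rintro φ hφ r
    obtain ⟨s, rfl⟩ := mem_ofOrder_zero.1 hφ
    rw [← map_mul, ← map_mul, mul_comm, sub_self]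
    exact Submodule.zero_mem _
  | succ n ih =>
    intro φ hφ r
    exact ih (mem_ofOrder_succ.1 hφ r)

theorem ofOrder_mono : Monotone (ofOrder k R) := monotone_nat_of_le_succ ofOrder_le_succ

theorem mul_mem_ofOrder {N : ℕ} : ∀ {m n : ℕ} {φ ψ : Module.End k R}, m + n = N →
    φ ∈ ofOrder k R m → ψ ∈ ofOrder k R n → φ * ψ ∈ ofOrder k R N := by
  induction N with
  | zero =>
    intro m n φ ψ h hφ hψ
    obtain ⟨rfl, rfl⟩ : m = 0 ∧ n = 0 := by omega
    obtain ⟨r, rfl⟩ := mem_ofOrder_zero.1 hφ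
    obtain ⟨s, rfl⟩ := mem_ofOrder_zero.1 hψ
    exact mem_ofOrder_zero.2 ⟨r * s, map_mul _ _ _⟩
  | succ N ih =>
    intro m n φ ψ h hφ hψ
    rw [mem_ofOrder_succ]
    intro r
    have e : φ * ψ * Algebra.lmul k R r - Algebra.lmul k R r * (φ * ψ) =
        φ * (ψ * Algebra.lmul k R r - Algebra.lmul k R r * ψ) +
          (φ * Algebra.lmul k R r - Algebra.lmul k R r * φ) * ψ := by
      simp only [mul_sub, sub_mul, mul_assoc]
      abel
    rw [e]
    refine Submodule.add_mem _ ?_ ?_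
    · cases n with
      | zero =>
        obtain ⟨s, rfl⟩ := mem_ofOrder_zero.1 hψ
        rw [← map_mul, ← map_mul, mul_comm, sub_self, mul_zero]
        exact Submodule.zero_mem _
      | succ n => exact ih (by omega) hφ (mem_ofOrder_succ.1 hψ r)
    · cases m with
      | zero =>
        obtain ⟨s, rfl⟩ := mem_ofOrder_zero.1 hφ
        rw [← map_mul, ← map_mul, mul_comm, sub_self, zero_mul]
        exact Submodule.zero_mem _
      | succ m => exact ih (by omega) (mem_ofOrder_succ.1 hφ r) hψ

theorem lmul_mem_ofOrder_zero (r : R) : Algebra.lmul k R r ∈ ofOrder k R 0 :=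
  mem_ofOrder_zero.2 ⟨r, rfl⟩

end DiffOp

/-- The ring `D_k(R)` of `k`-linear differential operators on `R`: the union of the modules of
operators of order at most `n`, as a subalgebra of `End_k(R)`. -/
def diffOps (k : Type*) [CommRing k] (R : Type*) [CommRing R] [Algebra k R] :
    Subalgebra k (Module.End k R) where
  carrier := {φ | ∃ n : ℕ, φ ∈ DiffOp.ofOrder k R n}
  mul_mem' := by
    rintro φ ψ ⟨m, hm⟩ ⟨n, hn⟩
    exact ⟨m + n, DiffOp.mul_mem_ofOrder rfl hm hn⟩
  add_mem' := by
    rintro φ ψ ⟨m, hm⟩ ⟨n, hn⟩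
    exact ⟨max m n, Submodule.add_mem _ (DiffOp.ofOrder_mono (le_max_left m n) hm)
      (DiffOp.ofOrder_mono (le_max_right m n) hn)⟩
  algebraMap_mem' := fun c => by
    refine ⟨0, DiffOp.mem_ofOrder_zero.2 ⟨algebraMap k R c, ?_⟩⟩
    exact (Algebra.lmul k R).commutes c

/-- An element `r` of `R`, regarded as the operator of order `0` in `D_k(R)` that multiplies
by `r`. -/
def diffOps.mulBy (k : Type*) [CommRing k] {R : Type*} [CommRing R] [Algebra k R] (r : R) :
    diffOps k R :=
  ⟨Algebra.lmul k R r, 0, DiffOp.lmul_mem_ofOrder_zero r⟩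

/-!
Everything rests on the divided-power operators `∂^(b)`, which make sense in every characteristic,
and on an inversion of the Leibniz rule, `sum_hasse_mul_hasse`: multiplication by `∂^(m) r` is a
signed sum of the operators `∂^(i) ∘ r ∘ ∂^(j)` with `i + j = m`.  On the face ring not every
`∂^(b)` is available, but `x^a ∂^(b)` is as soon as `st (supp a) ⊆ st (supp b)`
(`exists_diffOps_induces`).

Suppose a two-sided ideal contains multiplication by `r`, and let `x^a` be a monomial of `r` with
maximal exponent and invertible coefficient.  Then `∂^(a + c) (r x^c)` is that coefficient, so the
Leibniz inversion, multiplied on the left by `x^c ∂^(b)`, exhibits `x^c ∂^(b)` as an element of the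
ideal whenever the operators involved exist, that is, whenever
`st (supp c) ⊆ st (supp a ∪ supp c ∪ supp b)`.  This is `mem_of_mulBy_mem`, and it is used three
times.  With `r = x_σ` and `b = c = 0` it shows that `x_σ` generates the unit ideal when `st σ = K`.
With `b = 0` and `c` the indicator of `supp a` it shows that, over a field, an ideal containing `r`
contains the square-free parts of all monomials of `r` (`mulBy_faceMonomial_mem`).  With
`r = x^c = x_σ` it shows that the ideal generated by `x_σ` contains all operators `x^a ∂^(b)` with
`supp a = σ` and `st σ ⊆ st (supp b)` (`mem_of_induces_mulHasse`).

It remains to see that an ideal `I` is generated by the `x_σ` in it.  Let `T ∈ I` have order `N`.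
Its `N`-fold commutators with variables, indexed by multisets `b` of size `N`, are
multiplications by elements `p_b`, which lie in `I`; hence so do the square-free parts of their
monomials.  For a facet `F` the annihilator of `x_F` is stable under differential operators, which
forces every monomial `x^a` of `p_b` to satisfy `st (supp a) ⊆ st (supp b)`
(`closedStar_subset_of_iterAd_eq`).  So the operator `∑ p_b ∂^(b)` exists, lies in the ideal
generated by the `x_σ ∈ I`, and has the same leading part as `T`; subtracting it lowers the order,
and induction finishes the proof (`mem_of_forall_faceMonomial_mem`).
-/

open MvPolynomial

/-! ### Divided-power derivatives of polynomials -/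

namespace MvPolynomial

variable {V : Type*} {k : Type*} [CommRing k]

theorem add_mem_support_monomial_mul (a : V →₀ ℕ) (p : MvPolynomial V k) (e : V →₀ ℕ) :
    a + e ∈ (monomial a 1 * p).support ↔ e ∈ p.support := by
  rw [mem_support_iff, coeff_monomial_mul, one_mul, mem_support_iff]

theorem exists_eq_add_of_mem_support {a d : V →₀ ℕ} {p : MvPolynomial V k}
    (hd : d ∈ (monomial a 1 * p).support) : ∃ e ∈ p.support, d = a + e := by
  classical
  obtain ⟨a', ha', e, he, rfl⟩ := Finset.mem_add.1 (support_mul _ _ hd)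
  obtain rfl := Finset.mem_singleton.1 (support_monomial_subset ha')
  exact ⟨e, he, rfl⟩

variable [Fintype V]

/-- The divided-power (Hasse) derivative `∂^(b) = ∏ i, ∂ᵢ^{b i} / (b i)!` on polynomials, defined
over every coefficient ring by `x^e ↦ (∏ i, (e i).choose (b i)) x^(e - b)`.  The truncated
subtraction in the exponent is harmless: the coefficient vanishes unless `b ≤ e`. -/
noncomputable def hasse (b : V →₀ ℕ) : Module.End k (MvPolynomial V k) :=
  (basisMonomials V k).constr k fun e => monomial (e - b) ((∏ i, (e i).choose (b i) : ℕ) : k)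

theorem hasse_monomial (b e : V →₀ ℕ) (c : k) :
    hasse b (monomial e c) = monomial (e - b) (((∏ i, (e i).choose (b i) : ℕ) : k) * c) := by
  have h : (monomial e c : MvPolynomial V k) = c • basisMonomials V k e := by
    simp [smul_monomial]
  rw [h, map_smul, hasse, Module.Basis.constr_basis, smul_monomial, smul_eq_mul, mul_comm]

theorem prod_choose_eq_zero {b e : V →₀ ℕ} (h : ¬ b ≤ e) : ∏ i, (e i).choose (b i) = 0 := by
  rw [Finsupp.le_def] at h
  push Not at h
  obtain ⟨i, hi⟩ := h
  exact Finset.prod_eq_zero (Finset.mem_univ i) (Nat.choose_eq_zero_of_lt hi)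

theorem hasse_zero : hasse (0 : V →₀ ℕ) = (1 : Module.End k (MvPolynomial V k)) := by
  refine (basisMonomials V k).ext fun e => ?_
  simp [hasse_monomial]

theorem hasse_hasse (b c : V →₀ ℕ) (p : MvPolynomial V k) :
    hasse b (hasse c p) = ((∏ i, ((b + c) i).choose (c i) : ℕ) : k) • hasse (b + c) p := by
  suffices h : hasse b ∘ₗ hasse c =
      ((∏ i, ((b + c) i).choose (c i) : ℕ) : k) •
        (hasse (b + c) : Module.End k (MvPolynomial V k)) from
    LinearMap.congr_fun h p
  refine (basisMonomials V k).ext fun e => ?_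
  simp only [coe_basisMonomials, LinearMap.comp_apply, LinearMap.smul_apply, hasse_monomial,
    smul_monomial, tsub_tsub, mul_one, smul_eq_mul, add_comm c b]
  congr 1
  rw [← Nat.cast_mul, ← Nat.cast_mul, ← Finset.prod_mul_distrib, ← Finset.prod_mul_distrib]
  congr 1
  refine Finset.prod_congr rfl fun i _ => ?_
  have h := Nat.choose_mul (n := e i) (k := b i + c i) (s := c i) (Nat.le_add_left _ _)
  simp only [Nat.add_sub_cancel] at h
  simp only [Finsupp.coe_tsub, Finsupp.coe_add, Pi.sub_apply, Pi.add_apply]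
  rw [mul_comm, ← h, mul_comm]

/-- The commutator of a divided-power derivative with multiplication by a variable. -/
theorem hasse_X_mul_sub (b : V →₀ ℕ) (i : V) (p : MvPolynomial V k) :
    hasse b (X i * p) - X i * hasse b p =
      if b i = 0 then 0 else hasse (b - Finsupp.single i 1) p := by
  classical
  suffices h : hasse b ∘ₗ LinearMap.mulLeft k (X i) - LinearMap.mulLeft k (X i) ∘ₗ hasse b =
      if b i = 0 then 0 else
        (hasse (b - Finsupp.single i 1) : Module.End k (MvPolynomial V k)) by
    have := LinearMap.congr_fun h p
    split_ifs at this ⊢ <;> simpa using this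
  refine (basisMonomials V k).ext fun e => ?_
  have hX (f : V →₀ ℕ) (c : k) :
      (X i * monomial f c : MvPolynomial V k) = monomial (Finsupp.single i 1 + f) c := by
    rw [X, monomial_mul, one_mul]
  have hother (f g : V →₀ ℕ) : ∏ j ∈ Finset.univ.erase i,
      ((Finsupp.single i 1 + f : V →₀ ℕ) j).choose (g j) =
        ∏ j ∈ Finset.univ.erase i, (f j).choose (g j) :=
    Finset.prod_congr rfl fun j hj => by
      simp [(Finset.ne_of_mem_erase hj).symm]
  simp only [coe_basisMonomials, LinearMap.sub_apply, LinearMap.comp_apply,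
    LinearMap.mulLeft_apply, hX, hasse_monomial, mul_one]
  split_ifs with hb
  · have h1 : Finsupp.single i 1 + e - b = Finsupp.single i 1 + (e - b) := by
      ext j
      by_cases hj : i = j
      · subst hj; simp [hb]
      · simp [hj]
    have h2 : ∏ j, ((Finsupp.single i 1 + e : V →₀ ℕ) j).choose (b j) =
        ∏ j, (e j).choose (b j) := by
      rw [← Finset.mul_prod_erase _ _ (Finset.mem_univ i), hother,
        ← Finset.mul_prod_erase (a := i) _ _ (Finset.mem_univ i), hb]
      simp
    rw [h1, h2, sub_self, LinearMap.zero_apply]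
  · have h1 : Finsupp.single i 1 + e - b = e - (b - Finsupp.single i 1) := by
      ext j
      by_cases hj : i = j
      · subst hj
        simp only [Finsupp.coe_tsub, Finsupp.coe_add, Pi.sub_apply, Pi.add_apply,
          Finsupp.single_eq_same]
        omega
      · simp [hj]
    have h2 : ∏ j, ((Finsupp.single i 1 + e : V →₀ ℕ) j).choose (b j) =
        ∏ j, (e j).choose ((b - Finsupp.single i 1 : V →₀ ℕ) j) + ∏ j, (e j).choose (b j) := by
      rw [← Finset.mul_prod_erase _ _ (Finset.mem_univ i), hother,
        ← Finset.mul_prod_erase (a := i) (f := fun j => (e j).choose (b j)) _ (Finset.mem_univ i),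
        ← Finset.mul_prod_erase (a := i)
          (f := fun j => (e j).choose ((b - Finsupp.single i 1 : V →₀ ℕ) j)) _ (Finset.mem_univ i)]
      have h3 : ∏ j ∈ Finset.univ.erase i, (e j).choose ((b - Finsupp.single i 1 : V →₀ ℕ) j) =
          ∏ j ∈ Finset.univ.erase i, (e j).choose (b j) :=
        Finset.prod_congr rfl fun j hj => by
          simp [(Finset.ne_of_mem_erase hj).symm]
      obtain ⟨c, hc⟩ := Nat.exists_eq_succ_of_ne_zero hb
      rw [h3, ← add_mul]
      simp [hc, add_comm 1 (e i), Nat.choose_succ_succ]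
    rw [hasse_monomial, h1, h2]
    by_cases hbe : b ≤ e
    · have h4 : Finsupp.single i 1 + (e - b) = e - (b - Finsupp.single i 1) := by
        ext j
        have := hbe j
        by_cases hj : i = j
        · subst hj
          simp only [Finsupp.coe_tsub, Finsupp.coe_add, Pi.sub_apply, Pi.add_apply,
            Finsupp.single_eq_same]
          omega
        · simp [hj]
      rw [h4, ← map_sub, Nat.cast_add, add_sub_cancel_right, mul_one]
    · simp [prod_choose_eq_zero hbe]

/-- The coefficient of `t ^ m` in `((1 + t) - t) ^ e * (1 + t) ^ a = (1 + t) ^ a`. -/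
theorem sum_neg_one_pow_mul_choose_mul_choose (a e m : ℕ) :
    ∑ j ∈ Finset.range (m + 1), (-1 : ℤ) ^ j * (e.choose j * (a + (e - j)).choose (m - j) : ℕ) =
      a.choose m := by
  have h : ∑ j ∈ Finset.range (e + 1), (Polynomial.C ((-1 : ℤ) ^ j * e.choose j) *
      ((1 + Polynomial.X) ^ (a + (e - j)) * Polynomial.X ^ j)) = (1 + Polynomial.X) ^ a := by
    have := congr_arg (· * (1 + Polynomial.X) ^ a)
      (add_pow (-Polynomial.X : Polynomial ℤ) (1 + Polynomial.X) e)
    simp only [neg_add_cancel_comm_assoc, one_pow, one_mul, Finset.sum_mul] at this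
    rw [this]
    refine Finset.sum_congr rfl fun j _ => ?_
    rw [neg_pow (Polynomial.X : Polynomial ℤ), pow_add]
    simp only [map_mul, map_pow, map_neg, map_one, map_natCast]
    ring
  have h2 := congr_arg (fun p => Polynomial.coeff p m) h
  simp only [Polynomial.finsetSum_coeff, Polynomial.coeff_C_mul, Polynomial.coeff_mul_X_pow',
    Polynomial.coeff_one_add_X_pow] at h2
  have h3 : ∀ j ∈ Finset.range (m + 1),
      (-1 : ℤ) ^ j * (e.choose j * (a + (e - j)).choose (m - j) : ℕ) = (-1) ^ j * e.choose j *
        (if j ≤ m then ((a + (e - j)).choose (m - j) : ℤ) else 0) := fun j hj => by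
    rw [if_pos (Nat.lt_succ_iff.1 (Finset.mem_range.1 hj)), Nat.cast_mul, mul_assoc]
  -- The summands vanish for `j > m` and for `j > e`, so both sums may be taken over a longer range.
  rw [← h2, Finset.sum_congr rfl h3,
    Finset.sum_subset (Finset.range_mono (show m + 1 ≤ m + e + 1 by omega)),
    Finset.sum_subset (Finset.range_mono (show e + 1 ≤ m + e + 1 by omega))]
  · intro j _ hj
    rw [Nat.choose_eq_zero_of_lt (by simpa using hj)]
    simp
  · intro j _ hj
    rw [if_neg (by simpa using hj), mul_zero]

/-- Inversion of the Leibniz rule: a combination of the operators `∂^(m - j) ∘ r ∘ ∂^(j)` is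
multiplication by `∂^(m) r`.  Formally it is the coefficient of `t^m` in
`exp(t∂) ∘ r ∘ exp(-t∂) = r(x + t)`. -/
theorem sum_hasse_mul_hasse [DecidableEq V] (m : V →₀ ℕ) (r p : MvPolynomial V k) :
    ∑ j ∈ Fintype.piFinset fun i => Finset.range (m i + 1),
      (-1 : k) ^ (∑ i, j i) • hasse (m - Finsupp.equivFunOnFinite.symm j)
        (r * hasse (Finsupp.equivFunOnFinite.symm j) p) = hasse m r * p := by
  suffices h : ∑ j ∈ Fintype.piFinset fun i => Finset.range (m i + 1),
      (-1 : k) ^ (∑ i, j i) • ((LinearMap.mul k (MvPolynomial V k)).compr₂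
        (hasse (m - Finsupp.equivFunOnFinite.symm j))).compl₂
          (hasse (Finsupp.equivFunOnFinite.symm j)) =
      (LinearMap.mul k (MvPolynomial V k)) ∘ₗ hasse m by
    have := LinearMap.congr_fun₂ h r p
    simpa [LinearMap.sum_apply] using this
  refine (basisMonomials V k).ext fun a => (basisMonomials V k).ext fun e => ?_
  simp only [LinearMap.sum_apply, LinearMap.smul_apply, LinearMap.compl₂_apply,
    LinearMap.compr₂_apply, coe_basisMonomials, LinearMap.mul_apply', hasse_monomial,
    monomial_mul, LinearMap.comp_apply, mul_one, one_mul, smul_monomial]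
  trans ∑ j ∈ Fintype.piFinset fun i => Finset.range (m i + 1), monomial (a + e - m)
    (((∏ i, (-1 : ℤ) ^ j i * ((e i).choose (j i) * (a i + (e i - j i)).choose (m i - j i) : ℕ) :
      ℤ)) : k)
  · refine Finset.sum_congr rfl fun j hj => ?_
    have hjm : ∀ i, j i ≤ m i := fun i => by
      simpa [Nat.lt_succ_iff] using Fintype.mem_piFinset.1 hj i
    set j' : V →₀ ℕ := Finsupp.equivFunOnFinite.symm j with hj'
    have hj'j : ∀ i, j' i = j i := fun i => rfl
    have hc : (-1 : k) ^ (∑ i, j i) • (((∏ i, ((a + (e - j')) i).choose ((m - j') i) : ℕ) : k) *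
        ((∏ i, (e i).choose (j' i) : ℕ) : k)) = (((∏ i, (-1 : ℤ) ^ j i *
          ((e i).choose (j i) * (a i + (e i - j i)).choose (m i - j i) : ℕ) : ℤ)) : k) := by
      rw [Finset.prod_mul_distrib, Finset.prod_pow_eq_pow_sum, ← Nat.cast_prod,
        Finset.prod_mul_distrib]
      push_cast
      simp [hj'j, mul_comm]
    rw [hc]
    by_cases hje : j' ≤ e
    · congr 2
      ext i
      have := hje i
      have := hjm i
      simp only [Finsupp.coe_tsub, Finsupp.coe_add, Pi.sub_apply, Pi.add_apply, hj'j] at *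
      omega
    · rw [← hc, prod_choose_eq_zero hje]
      simp
  · rw [← map_sum, ← Int.cast_sum,
      ← Finset.prod_univ_sum (fun i => Finset.range (m i + 1)) fun i j =>
        (-1 : ℤ) ^ j * ((e i).choose j * (a i + (e i - j)).choose (m i - j) : ℕ)]
    simp only [sum_neg_one_pow_mul_choose_mul_choose]
    by_cases hma : m ≤ a
    · rw [tsub_add_eq_add_tsub hma]
      simp
    · rw [← Nat.cast_prod, prod_choose_eq_zero hma]
      simp

end MvPolynomial

/-! ### The face ideal and closed stars -/

namespace SimplicialCpx

variable {V : Type*} {k : Type*} [CommRing k] (K : SimplicialCpx V)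

theorem prod_X_eq_monomial (σ : Finset V) :
    (∏ i ∈ σ, X i : MvPolynomial V k) = monomial (∑ i ∈ σ, Finsupp.single i 1) 1 := by
  rw [monomial_sum_one]
  rfl

theorem sum_single_apply [DecidableEq V] (σ : Finset V) (j : V) :
    (∑ i ∈ σ, Finsupp.single i 1 : V →₀ ℕ) j = if j ∈ σ then 1 else 0 := by
  simp [Finsupp.finsetSum_apply, Finsupp.single_apply]

theorem sum_single_le_iff (σ : Finset V) (a : V →₀ ℕ) :
    ∑ i ∈ σ, Finsupp.single i 1 ≤ a ↔ σ ⊆ a.support := by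
  classical
  simp only [Finsupp.le_def, sum_single_apply, Finset.subset_iff, Finsupp.mem_support_iff]
  refine forall_congr' fun j => ?_
  split_ifs with h <;> simp [h, Nat.one_le_iff_ne_zero]

theorem support_sum_single (σ : Finset V) :
    (∑ i ∈ σ, Finsupp.single i 1 : V →₀ ℕ).support = σ := by
  classical
  ext j
  simp [Finsupp.mem_support_iff, sum_single_apply]

/-- The face ideal is spanned over the coefficients by the monomials supported on non-faces. -/
theorem mem_faceIdeal_iff {p : MvPolynomial V k} :
    p ∈ K.faceIdeal k ↔ ∀ a ∈ p.support, a.support ∉ K.faces := by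
  have h : {f : MvPolynomial V k | ∃ σ : Finset V, σ ∉ K.faces ∧ f = ∏ i ∈ σ, X i} =
      (fun s => monomial s (1 : k)) ''
        ((fun σ : Finset V => ∑ i ∈ σ, Finsupp.single i 1) '' {σ | σ ∉ K.faces}) := by
    ext f
    constructor
    · rintro ⟨σ, hσ, rfl⟩
      exact ⟨_, ⟨σ, hσ, rfl⟩, (prod_X_eq_monomial σ).symm⟩
    · rintro ⟨_, ⟨σ, hσ, rfl⟩, rfl⟩
      exact ⟨σ, hσ, (prod_X_eq_monomial σ).symm⟩
  rw [faceIdeal, h, mem_ideal_span_monomial_image]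
  refine forall₂_congr fun a _ => ⟨?_, fun ha => ?_⟩
  · rintro ⟨_, ⟨σ, hσ, rfl⟩, hle⟩ ha
    exact hσ (K.down_closed ha ((sum_single_le_iff σ a).1 hle))
  · exact ⟨_, ⟨_, ha, rfl⟩, (sum_single_le_iff _ a).2 subset_rfl⟩

theorem monomial_mem_faceIdeal {a : V →₀ ℕ} (ha : a.support ∉ K.faces) (c : k) :
    monomial a c ∈ K.faceIdeal k := by
  refine K.mem_faceIdeal_iff.2 fun e he => ?_
  obtain rfl := Finset.mem_singleton.1 (support_monomial_subset he)
  exact ha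

/-- To check that a linear map preserves the face ideal it suffices to look at monomials. -/
theorem map_mem_faceIdeal {Φ : Module.End k (MvPolynomial V k)}
    (h : ∀ e : V →₀ ℕ, e.support ∉ K.faces → ∀ c, Φ (monomial e c) ∈ K.faceIdeal k)
    {p : MvPolynomial V k} (hp : p ∈ K.faceIdeal k) : Φ p ∈ K.faceIdeal k := by
  rw [p.as_sum, map_sum]
  exact Ideal.sum_mem _ fun e he => h e (K.mem_faceIdeal_iff.1 hp e he) _

variable [DecidableEq V]

theorem closedStar_subset_closedStar_union {σ τ : Finset V}
    (h : K.closedStar σ ⊆ K.closedStar τ) : K.closedStar σ ⊆ K.closedStar (σ ∪ τ) := by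
  rintro ρ ⟨h1, h2⟩
  refine ⟨h1, ?_⟩
  rw [← Finset.union_assoc]
  refine (h ⟨h2, ?_⟩).2
  rwa [Finset.union_assoc, Finset.union_self]

theorem closedStar_anti {σ τ : Finset V} (h : σ ⊆ τ) : K.closedStar τ ⊆ K.closedStar σ :=
  fun _ hρ => ⟨hρ.1, K.down_closed hρ.2 (Finset.union_subset_union_right h)⟩

/-- If every facet containing `σ` contains `τ`, then the star of `σ` lies in that of `τ`. -/
theorem closedStar_subset_of_forall_maximal [Finite V] {σ τ : Finset V}
    (h : ∀ F, Maximal (· ∈ K.faces) F → σ ⊆ F → τ ⊆ F) : K.closedStar σ ⊆ K.closedStar τ := by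
  rintro ρ ⟨h1, h2⟩
  obtain ⟨F, hle, hF⟩ := (Set.toFinite K.faces).exists_le_maximal h2
  exact ⟨h1, K.down_closed hF.prop (Finset.union_subset
    (Finset.subset_union_left.trans hle) (h F hF (Finset.subset_union_right.trans hle)))⟩

end SimplicialCpx

/-! ### Generalities on differential operators -/

namespace DiffOp

variable {k : Type*} [CommRing k] {R : Type*} [CommRing R] [Algebra k R]

theorem lmul_apply (r s : R) : Algebra.lmul k R r s = r * s := rfl

theorem mulBy_mul (r s : R) :
    diffOps.mulBy k (r * s) = diffOps.mulBy k r * diffOps.mulBy k s :=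
  Subtype.ext (map_mul (Algebra.lmul k R) r s)

theorem mulBy_sub (r s : R) :
    diffOps.mulBy k (r - s) = diffOps.mulBy k r - diffOps.mulBy k s :=
  Subtype.ext (map_sub (Algebra.lmul k R) r s)

theorem commutator_add {A : Type*} [Ring A] (x s t : A) :
    (s + t) * x - x * (s + t) = (s * x - x * s) + (t * x - x * t) := by
  noncomm_ring

theorem commutator_smul {A : Type*} [Ring A] [Algebra k A] (c : k) (x t : A) :
    (c • t) * x - x * (c • t) = c • (t * x - x * t) := by
  rw [smul_mul_assoc, mul_smul_comm, smul_sub]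

theorem commutator_comm {A : Type*} [Ring A] {x y : A} (h : x * y = y * x) (t : A) :
    (t * y - y * t) * x - x * (t * y - y * t) = (t * x - x * t) * y - y * (t * x - x * t) := by
  simp only [sub_mul, mul_sub]
  rw [mul_assoc t, ← h, ← mul_assoc, ← mul_assoc x y t, h]
  simp only [mul_assoc]
  abel

theorem smul_mem_of_mem {A : Type*} [Ring A] [Algebra k A] (J : TwoSidedIdeal A) (c : k)
    {x : A} (hx : x ∈ J) : c • x ∈ J := by
  rw [Algebra.smul_def]
  exact J.mul_mem_left _ _ hx

/-- Differential operators preserve annihilators of elements whose square has no larger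
annihilator. -/
theorem mul_apply_eq_zero {x : R} (hx : ∀ z, x * (x * z) = 0 → x * z = 0) {N : ℕ} :
    ∀ {φ : Module.End k R}, φ ∈ ofOrder k R N → ∀ {y : R}, x * y = 0 → x * φ y = 0 := by
  induction N with
  | zero =>
    rintro _ ⟨r, rfl⟩ y hy
    change x * (r * y) = 0
    rw [mul_left_comm, hy, mul_zero]
  | succ N ih =>
    intro φ hφ y hy
    have h := ih (hφ x) hy
    rw [LinearMap.sub_apply, Module.End.mul_apply, Module.End.mul_apply,
      lmul_apply, lmul_apply, hy, map_zero, zero_sub, mul_neg, neg_eq_zero] at h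
    exact hx _ h

variable {V : Type*}

/-- The order of an operator can be tested on commutators with generators of the algebra. -/
theorem mem_ofOrder_succ_of_surjective {f : MvPolynomial V k →ₐ[k] R}
    (hf : Function.Surjective f) {N : ℕ} {φ : Module.End k R}
    (h : ∀ i, φ * Algebra.lmul k R (f (X i)) - Algebra.lmul k R (f (X i)) * φ ∈ ofOrder k R N) :
    φ ∈ ofOrder k R (N + 1) := by
  rw [mem_ofOrder_succ]
  intro r
  obtain ⟨p, rfl⟩ := hf r
  induction p using MvPolynomial.induction_on with
  | C a =>
    have : Algebra.lmul k R (f (C a)) = algebraMap k _ a := by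
      rw [← algebraMap_eq, AlgHom.commutes, AlgHom.commutes]
    rw [this, Algebra.commutes, sub_self]
    exact Submodule.zero_mem _
  | add p q hp hq =>
    convert Submodule.add_mem _ hp hq using 1
    simp only [map_add]
    noncomm_ring
  | mul_X p i hp =>
    convert Submodule.add_mem _
      (mul_mem_ofOrder (add_zero N) hp (lmul_mem_ofOrder_zero (k := k) (f (X i))))
      (mul_mem_ofOrder (zero_add N) (lmul_mem_ofOrder_zero (k := k) (f p)) (h i)) using 1
    simp only [map_mul, mul_sub, sub_mul, mul_assoc]
    abel

/-- An endomorphism commuting with the generators of the algebra is a multiplication. -/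
theorem eq_lmul_of_commute {f : MvPolynomial V k →ₐ[k] R} (hf : Function.Surjective f)
    {φ : Module.End k R}
    (h : ∀ i, φ * Algebra.lmul k R (f (X i)) = Algebra.lmul k R (f (X i)) * φ) :
    φ = Algebra.lmul k R (φ 1) := by
  ext r
  obtain ⟨p, rfl⟩ := hf r
  rw [lmul_apply]
  induction p using MvPolynomial.induction_on with
  | C a =>
    rw [← algebraMap_eq, AlgHom.commutes, Algebra.algebraMap_eq_smul_one, map_smul, mul_smul_comm,
      mul_one]
  | add p q hp hq => rw [map_add, map_add, hp, hq, mul_add]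
  | mul_X p i hp =>
    have := LinearMap.congr_fun (h i) (f p)
    simp only [Module.End.mul_apply, lmul_apply] at this
    rw [map_mul, mul_comm, this, hp]
    ring

end DiffOp

/-! ### Divided-power operators on the face ring -/

namespace SimplicialCpx

variable {V : Type*} {k : Type*} [CommRing k] (K : SimplicialCpx V)

/-- The projection from the polynomial ring to the face ring, as a map of `k`-algebras. -/
noncomputable abbrev toFaceRing : MvPolynomial V k →ₐ[k] K.FaceRing k :=
  Ideal.Quotient.mkₐ k (K.faceIdeal k)

theorem toFaceRing_surjective : Function.Surjective (K.toFaceRing (k := k)) :=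
  Ideal.Quotient.mkₐ_surjective _ _

theorem toFaceRing_eq_zero_iff {p : MvPolynomial V k} :
    K.toFaceRing p = 0 ↔ p ∈ K.faceIdeal k :=
  Ideal.Quotient.eq_zero_iff_mem

theorem faceMonomial_eq (σ : Finset V) :
    K.faceMonomial k σ = K.toFaceRing (monomial (∑ i ∈ σ, Finsupp.single i 1) 1) := by
  rw [← prod_X_eq_monomial]
  rfl

/-- The endomorphism `φ` of the face ring is induced by the endomorphism `Φ` of the polynomial
ring. -/
def Induces (Φ : Module.End k (MvPolynomial V k)) (φ : Module.End k (K.FaceRing k)) : Prop :=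
  ∀ p, φ (K.toFaceRing p) = K.toFaceRing (Φ p)

variable {K}

theorem Induces.unique {Φ : Module.End k (MvPolynomial V k)} {φ ψ : Module.End k (K.FaceRing k)}
    (hφ : K.Induces Φ φ) (hψ : K.Induces Φ ψ) : φ = ψ := by
  refine LinearMap.ext fun r => ?_
  obtain ⟨p, rfl⟩ := K.toFaceRing_surjective r
  rw [hφ p, hψ p]

theorem Induces.congr {Φ Ψ : Module.End k (MvPolynomial V k)} {φ : Module.End k (K.FaceRing k)}
    (hφ : K.Induces Φ φ) (h : ∀ p, Φ p = Ψ p) : K.Induces Ψ φ := fun p => by rw [hφ p, h p]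

theorem exists_induces {Φ : Module.End k (MvPolynomial V k)}
    (h : ∀ p ∈ K.faceIdeal k, Φ p ∈ K.faceIdeal k) : ∃ φ, K.Induces Φ φ := by
  have hΦ : ∀ p q, K.toFaceRing p = K.toFaceRing q → K.toFaceRing (Φ p) = K.toFaceRing (Φ q) := by
    intro p q hpq
    rw [← sub_eq_zero, ← map_sub, toFaceRing_eq_zero_iff] at hpq ⊢
    rw [← map_sub]
    exact h _ hpq
  have hinv := Function.surjInv_eq (K.toFaceRing_surjective (k := k))
  refine ⟨{ toFun := fun r => K.toFaceRing (Φ (Function.surjInv K.toFaceRing_surjective r))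
            map_add' := fun r s => ?_
            map_smul' := fun c r => ?_ }, fun p => hΦ _ _ (hinv _)⟩
  · rw [← map_add, ← map_add]
    exact hΦ _ _ (by rw [hinv, map_add, hinv, hinv])
  · rw [RingHom.id_apply, ← map_smul, ← map_smul]
    exact hΦ _ _ (by rw [hinv, map_smul, hinv])

theorem induces_lmul (p : MvPolynomial V k) :
    K.Induces (LinearMap.mulLeft k p) (Algebra.lmul k _ (K.toFaceRing p)) := fun q => by
  rw [DiffOp.lmul_apply, LinearMap.mulLeft_apply, map_mul]

variable [Fintype V]

/-- The operator `p ∂^(b)` on the polynomial ring. -/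
noncomputable def mulHasse (p : MvPolynomial V k) (b : V →₀ ℕ) :
    Module.End k (MvPolynomial V k) :=
  LinearMap.mulLeft k p * hasse b

theorem mulHasse_apply (p q : MvPolynomial V k) (b : V →₀ ℕ) :
    mulHasse p b q = p * hasse b q := rfl

/-- The derivative `∂^(a + c)` kills every monomial of `r x^c` except the one coming from `x^a`,
when the exponent `a` is maximal in `r`. -/
theorem hasse_mul_monomial {r : MvPolynomial V k} {a c : V →₀ ℕ}
    (ha : ∀ e ∈ r.support, a ≤ e → e = a) :
    hasse (a + c) (r * monomial c 1) = C (r.coeff a) := by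
  conv_lhs => rw [r.as_sum, Finset.sum_mul, map_sum]
  rw [Finset.sum_eq_single a]
  · rw [monomial_mul, hasse_monomial]
    simp
  · intro e he hea
    rw [monomial_mul, hasse_monomial, prod_choose_eq_zero]
    · simp
    · rw [add_le_add_iff_right]
      exact fun h => hea (ha e he h)
  · intro h
    rw [notMem_support_iff.1 h]
    simp

theorem Induces.commutator {p : MvPolynomial V k} {b : V →₀ ℕ} {φ : Module.End k (K.FaceRing k)}
    (h : K.Induces (mulHasse p b) φ) (i : V) :
    K.Induces (if b i = 0 then 0 else mulHasse p (b - Finsupp.single i 1))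
      (φ * Algebra.lmul k _ (K.toFaceRing (X i)) - Algebra.lmul k _ (K.toFaceRing (X i)) * φ) := by
  intro q
  rw [LinearMap.sub_apply, Module.End.mul_apply, Module.End.mul_apply, DiffOp.lmul_apply,
    DiffOp.lmul_apply, ← map_mul, h, h, ← map_mul, ← map_sub, mulHasse_apply, mulHasse_apply,
    mul_left_comm, ← mul_sub, hasse_X_mul_sub]
  split_ifs <;> simp [mulHasse_apply]

/-- An operator induced by `p ∂^(b)` has order at most `|b|`. -/
theorem Induces.mem_ofOrder {N : ℕ} : ∀ {p : MvPolynomial V k} {b : V →₀ ℕ}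
    {φ : Module.End k (K.FaceRing k)}, b.degree = N → K.Induces (mulHasse p b) φ →
      φ ∈ DiffOp.ofOrder k (K.FaceRing k) N := by
  induction N with
  | zero =>
    intro p b φ hb h
    obtain rfl := (Finsupp.degree_eq_zero_iff b).1 hb
    refine ⟨K.toFaceRing p, (induces_lmul p).unique (h.congr fun q => ?_)⟩
    rw [mulHasse_apply, hasse_zero]
    rfl
  | succ N ih =>
    intro p b φ hb h
    refine DiffOp.mem_ofOrder_succ_of_surjective K.toFaceRing_surjective fun i => ?_
    have hi := h.commutator i
    split_ifs at hi with hbi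
    · have h0 : K.Induces 0 (0 : Module.End k (K.FaceRing k)) := fun p => by simp
      rw [hi.unique h0]
      exact Submodule.zero_mem _
    · refine ih ?_ hi
      have hle : Finsupp.single i 1 ≤ b := by
        rw [Finsupp.single_le_iff]
        exact Nat.one_le_iff_ne_zero.2 hbi
      have := congr_arg Finsupp.degree (tsub_add_cancel_of_le hle)
      rw [map_add, Finsupp.degree_single] at this
      omega

variable [DecidableEq V]

/-- The operator `p ∂^(b)` descends to a differential operator on the face ring as soon as
`st (supp a) ⊆ st (supp b)` for every monomial `x^a` of `p`. -/
theorem exists_diffOps_induces {p : MvPolynomial V k} {b : V →₀ ℕ}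
    (h : ∀ a ∈ p.support, K.closedStar a.support ⊆ K.closedStar b.support) :
    ∃ T : diffOps k (K.FaceRing k), K.Induces (mulHasse p b) T.1 := by
  suffices hp : ∀ q ∈ K.faceIdeal k, mulHasse p b q ∈ K.faceIdeal k by
    obtain ⟨φ, hφ⟩ := exists_induces hp
    exact ⟨⟨φ, _, hφ.mem_ofOrder rfl⟩, hφ⟩
  refine fun q hq => K.map_mem_faceIdeal (fun e he c => ?_) hq
  rw [mulHasse_apply, hasse_monomial]
  by_cases hbe : b ≤ e
  · refine K.mem_faceIdeal_iff.2 fun d hd hdK => he ?_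
    obtain ⟨a, ha, e', he', rfl⟩ := Finset.mem_add.1 (support_mul _ _ hd)
    obtain rfl := Finset.mem_singleton.1 (support_monomial_subset he')
    have hmem : (a + (e - b)).support ∈ K.closedStar a.support := by
      refine ⟨hdK, ?_⟩
      rwa [Finset.union_eq_left.2 (Finsupp.support_mono le_self_add)]
    refine K.down_closed (h a ha hmem).2 fun i hi => ?_
    simp only [Finset.mem_union, Finsupp.mem_support_iff, Finsupp.coe_add, Finsupp.coe_tsub,
      Pi.add_apply, Pi.sub_apply] at hi ⊢
    omega
  · rw [prod_choose_eq_zero hbe]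
    simp

/-! ### Extracting operators from one multiplication in an ideal -/

/-- If a two-sided ideal contains multiplication by `r`, and `x^a` is a monomial of `r` of maximal
exponent and invertible coefficient, then the ideal contains every operator `x^c ∂^(b)` with
`st (supp c) ⊆ st (supp a ∪ supp c ∪ supp b)`: it is the invertible coefficient times
`x^c ∂^(b) ∂^(a + c) (r x^c)`, which inverting the Leibniz rule writes as a sum of
products `(x^c ∂^(b) ∂^(i)) r (x^c ∂^(j))`. -/
theorem mem_of_mulBy_mem {J : TwoSidedIdeal (diffOps k (K.FaceRing k))} {r : MvPolynomial V k}
    (hr : diffOps.mulBy k (K.toFaceRing r) ∈ J) {a : V →₀ ℕ}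
    (ha : ∀ e ∈ r.support, a ≤ e → e = a) (hu : IsUnit (r.coeff a)) {b c : V →₀ ℕ}
    (hst : K.closedStar c.support ⊆ K.closedStar (a.support ∪ c.support ∪ b.support))
    {T : diffOps k (K.FaceRing k)} (hT : K.Induces (mulHasse (monomial c 1) b) T.1) : T ∈ J := by
  -- The derivatives below have exponents at most `a + b + c`, which the star condition covers.
  have hex : ∀ d : V →₀ ℕ, d ≤ b + (a + c) →
      ∃ U : diffOps k (K.FaceRing k), K.Induces (mulHasse (monomial c 1) d) U.1 := fun d hd => by
    refine exists_diffOps_induces fun e he => ?_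
    obtain rfl := Finset.mem_singleton.1 (support_monomial_subset he)
    refine hst.trans (K.closedStar_anti fun i hi => ?_)
    have := hd i
    simp only [Finset.mem_union, Finsupp.mem_support_iff, Finsupp.coe_add, Pi.add_apply]
      at hi this ⊢
    omega
  choose! U hU using hex
  set m := a + c with hm
  have key : r.coeff a • T = ∑ j ∈ Fintype.piFinset fun i => Finset.range (m i + 1),
      ((-1 : k) ^ (∑ i, j i) * ((∏ i, ((b + (m - Finsupp.equivFunOnFinite.symm j)) i).choose
        ((m - Finsupp.equivFunOnFinite.symm j) i) : ℕ) : k)) •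
          (U (b + (m - Finsupp.equivFunOnFinite.symm j)) * diffOps.mulBy k (K.toFaceRing r) *
            U (Finsupp.equivFunOnFinite.symm j)) := by
    refine Subtype.ext (LinearMap.ext fun q => ?_)
    obtain ⟨q, rfl⟩ := K.toFaceRing_surjective q
    have h1 : (r.coeff a • T).1 (K.toFaceRing q) =
        K.toFaceRing (monomial c 1 * hasse b (hasse m (r * monomial c 1) * q)) := by
      rw [hasse_mul_monomial ha, ← smul_eq_C_mul, map_smul, mul_smul_comm, map_smul,
        ← mulHasse_apply, ← hT]
      rfl
    rw [h1, ← sum_hasse_mul_hasse, map_sum, Finset.mul_sum, map_sum,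
      AddSubmonoidClass.coe_finsetSum, LinearMap.sum_apply]
    refine Finset.sum_congr rfl fun j hj => ?_
    have hjm : Finsupp.equivFunOnFinite.symm j ≤ m := fun i => by
      simpa [Nat.lt_succ_iff] using Fintype.mem_piFinset.1 hj i
    have h2 := hU _ (add_le_add_right (tsub_le_self (a := m)
      (b := Finsupp.equivFunOnFinite.symm j)) b)
    have h3 := hU _ (hjm.trans le_add_self)
    change _ = (_ * _ : k) • (U _).1 (K.toFaceRing r * (U _).1 (K.toFaceRing q))
    rw [h3, ← map_mul, h2, ← map_smul K.toFaceRing, mulHasse_apply, mulHasse_apply,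
      map_smul (hasse b), hasse_hasse, mul_smul, mul_smul_comm, mul_smul_comm, mul_assoc r]
  obtain ⟨u, hu⟩ := hu
  have h4 : r.coeff a • T ∈ J := by
    rw [key]
    exact sum_mem fun j _ => DiffOp.smul_mem_of_mem J _
      (J.mul_mem_right _ _ (J.mul_mem_left _ _ hr))
  have h5 := DiffOp.smul_mem_of_mem J (↑u⁻¹ : k) h4
  rwa [← hu, smul_smul, Units.inv_mul, one_smul] at h5

end SimplicialCpx

/-! ### Square-free parts of monomials -/

namespace SimplicialCpx

variable {V : Type*} {k : Type*} [CommRing k] {K : SimplicialCpx V}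

theorem monomial_eq_mul_monomial_support (a : V →₀ ℕ) (c : k) :
    (monomial a c : MvPolynomial V k) =
      monomial (a - ∑ i ∈ a.support, Finsupp.single i 1) c *
        monomial (∑ i ∈ a.support, Finsupp.single i 1) 1 := by
  rw [monomial_mul, mul_one, tsub_add_cancel_of_le ((sum_single_le_iff _ _).2 subset_rfl)]

theorem monomial_mul_faceMonomial (a : V →₀ ℕ) (c : k) :
    K.toFaceRing (monomial a c) =
      K.toFaceRing (monomial (a - ∑ i ∈ a.support, Finsupp.single i 1) c) *
        K.faceMonomial k a.support := by
  conv_lhs => rw [monomial_eq_mul_monomial_support]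
  rw [map_mul, faceMonomial_eq]

/-- The annihilator of `x_σ` equals that of its square, as the face ideal is square-free. -/
theorem faceMonomial_mul_eq_zero_of_sq (σ : Finset V) (z : K.FaceRing k)
    (h : K.faceMonomial k σ * (K.faceMonomial k σ * z) = 0) : K.faceMonomial k σ * z = 0 := by
  obtain ⟨q, rfl⟩ := K.toFaceRing_surjective z
  rw [faceMonomial_eq, ← map_mul] at h ⊢
  rw [← map_mul] at h
  rw [toFaceRing_eq_zero_iff, mem_faceIdeal_iff] at h ⊢
  intro d hd
  have := h _ ((add_mem_support_monomial_mul _ _ _).2 hd)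
  obtain ⟨e, he, rfl⟩ := exists_eq_add_of_mem_support hd
  convert this using 2
  ext i
  simp only [Finsupp.mem_support_iff, Finsupp.coe_add, Pi.add_apply]
  omega

/-! ### Iterated commutators with the variables -/

/-- The commutator `T ↦ T xᵢ - xᵢ T` with a variable, on differential operators of the face
ring. -/
noncomputable def ad (k : Type*) [CommRing k] (K : SimplicialCpx V) (i : V) :
    Module.End k (diffOps k (K.FaceRing k)) :=
  letI x := diffOps.mulBy k (K.toFaceRing (X i : MvPolynomial V k))
  { toFun := fun T => T * x - x * T
    map_add' := fun S T => DiffOp.commutator_add x S T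
    map_smul' := fun c T => DiffOp.commutator_smul c x T }

theorem ad_apply_coe (i : V) (T : diffOps k (K.FaceRing k)) :
    (ad k K i T).1 = T.1 * Algebra.lmul k _ (K.toFaceRing (X i : MvPolynomial V k)) -
      Algebra.lmul k _ (K.toFaceRing (X i : MvPolynomial V k)) * T.1 := rfl

theorem ad_mul_ad (i j : V) : ad k K i * ad k K j = ad k K j * ad k K i := by
  refine LinearMap.ext fun T => ?_
  have h : Commute (diffOps.mulBy k (K.toFaceRing (X i : MvPolynomial V k)))
      (diffOps.mulBy k (K.toFaceRing (X j : MvPolynomial V k))) := by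
    change _ * _ = _ * _
    rw [← DiffOp.mulBy_mul, mul_comm, DiffOp.mulBy_mul]
  exact DiffOp.commutator_comm h.eq T

instance leftCommutative_ad : LeftCommutative fun (i : V)
    (f : Module.End k (diffOps k (K.FaceRing k))) => ad k K i * f :=
  ⟨fun i j f => by rw [← mul_assoc, ad_mul_ad, mul_assoc]⟩

/-- The iterated commutator with the variables in the multiset `s`; the order is irrelevant
because these commutators commute. -/
noncomputable def iterAd (k : Type*) [CommRing k] (K : SimplicialCpx V) (s : Multiset V) :
    Module.End k (diffOps k (K.FaceRing k)) :=
  s.foldr (fun i f => ad k K i * f) 1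

theorem iterAd_cons (i : V) (s : Multiset V) (T : diffOps k (K.FaceRing k)) :
    iterAd k K (i ::ₘ s) T = ad k K i (iterAd k K s T) := by
  rw [iterAd, Multiset.foldr_cons]
  rfl

theorem iterAd_mem {J : TwoSidedIdeal (diffOps k (K.FaceRing k))}
    {T : diffOps k (K.FaceRing k)} (hT : T ∈ J) (s : Multiset V) : iterAd k K s T ∈ J := by
  induction s using Multiset.induction_on with
  | empty => exact hT
  | cons i s ih =>
    rw [iterAd_cons]
    exact J.sub_mem (J.mul_mem_right _ _ ih) (J.mul_mem_left _ _ ih)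

theorem iterAd_mem_ofOrder {T : diffOps k (K.FaceRing k)} (s : Multiset V) {N : ℕ}
    (hT : T.1 ∈ DiffOp.ofOrder k _ (N + s.card)) :
    (iterAd k K s T).1 ∈ DiffOp.ofOrder k (K.FaceRing k) N := by
  induction s using Multiset.induction_on generalizing N with
  | empty => exact hT
  | cons i s ih =>
    rw [iterAd_cons]
    refine ih (N := N + 1) ?_ (K.toFaceRing (X i : MvPolynomial V k))
    rwa [add_right_comm, add_assoc, ← Multiset.card_cons i s]

theorem exists_iterAd_eq_zero (T : diffOps k (K.FaceRing k)) :
    ∃ N, ∀ s : Multiset V, s.card = N → iterAd k K s T = 0 := by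
  obtain ⟨φ, N, hN⟩ := T
  refine ⟨N + 1, fun s hs => ?_⟩
  obtain ⟨i, hi⟩ := Multiset.card_pos_iff_exists_mem.1 (N.succ_pos.trans_eq hs.symm)
  obtain ⟨s, rfl⟩ := Multiset.exists_cons_of_mem hi
  rw [Multiset.card_cons, Nat.add_right_cancel_iff] at hs
  obtain ⟨r, hr⟩ := iterAd_mem_ofOrder (T := ⟨φ, N, hN⟩) s (N := 0)
    (by rwa [zero_add, hs])
  rw [iterAd_cons]
  refine Subtype.ext ?_
  rw [ad_apply_coe, ← hr]
  change Algebra.lmul k _ r * _ - _ * Algebra.lmul k _ r = 0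
  rw [← map_mul, ← map_mul, mul_comm, sub_self]

/-! ### Two-sided ideals and the monomials they contain -/

variable [Fintype V]

theorem induces_mulBy (p : MvPolynomial V k) :
    K.Induces (mulHasse p 0) (diffOps.mulBy k (K.toFaceRing p)).1 :=
  (induces_lmul p).congr fun q => by
    rw [mulHasse_apply, hasse_zero]
    rfl

variable [DecidableEq V]

/-- A two-sided ideal containing multiplication by `r` contains multiplication by the square-free
part of every monomial of `r`. -/
theorem mulBy_faceMonomial_mem (hk : IsField k) (J : TwoSidedIdeal (diffOps k (K.FaceRing k)))
    (r : MvPolynomial V k) (hr : diffOps.mulBy k (K.toFaceRing r) ∈ J) :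
    ∀ a ∈ r.support, diffOps.mulBy k (K.faceMonomial k a.support) ∈ J := by
  induction h : r.support using Finset.strongInduction generalizing r with
  | H s ih =>
    intro a has
    obtain ⟨d, hds, hd⟩ := s.exists_maximal ⟨a, has⟩
    subst h
    have hu : IsUnit (r.coeff d) := by
      obtain ⟨u, hu⟩ := hk.mul_inv_cancel (mem_support_iff.1 hds)
      exact IsUnit.of_mul_eq_one _ hu
    have hdJ : diffOps.mulBy k (K.faceMonomial k d.support) ∈ J := by
      rw [faceMonomial_eq]
      refine mem_of_mulBy_mem hr (fun e he hde => le_antisymm (hd he hde) hde) hu ?_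
        (induces_mulBy _)
      rw [support_sum_single, Finset.union_self, Finsupp.support_zero, Finset.union_empty]
    by_cases had : a = d
    · rwa [had]
    have hsub : (r - monomial d (r.coeff d)).support ⊂ r.support := by
      refine Finset.ssubset_iff_of_subset (fun e he => ?_) |>.2 ⟨d, hds, ?_⟩
      · rw [mem_support_iff, coeff_sub, coeff_monomial] at he
        rw [mem_support_iff]
        split_ifs at he with hde
        · subst hde; simp at he
        · simpa using he
      · simp
    refine ih _ hsub (r - monomial d (r.coeff d)) ?_ rfl a ?_
    · rw [map_sub, DiffOp.mulBy_sub, monomial_mul_faceMonomial, DiffOp.mulBy_mul]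
      exact J.sub_mem hr (J.mul_mem_left _ _ hdJ)
    · rw [mem_support_iff, coeff_sub, coeff_monomial, if_neg (Ne.symm had), sub_zero]
      exact mem_support_iff.1 has

/-- If a two-sided ideal contains `x_(supp a)` for every monomial `x^a` of `p`, then it contains
the operator induced by `p ∂^(b)`. -/
theorem mem_of_induces_mulHasse {J : TwoSidedIdeal (diffOps k (K.FaceRing k))}
    {p : MvPolynomial V k} {b : V →₀ ℕ}
    (hJ : ∀ a ∈ p.support, diffOps.mulBy k (K.faceMonomial k a.support) ∈ J)
    (hst : ∀ a ∈ p.support, K.closedStar a.support ⊆ K.closedStar b.support)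
    {T : diffOps k (K.FaceRing k)} (hT : K.Induces (mulHasse p b) T.1) : T ∈ J := by
  have hex : ∀ a ∈ p.support, ∃ U ∈ J,
      K.Induces (mulHasse (monomial (∑ i ∈ a.support, Finsupp.single i 1) 1) b) U.1 := by
    intro a ha
    obtain ⟨U, hU⟩ := exists_diffOps_induces (K := K) (k := k) (b := b)
      (p := monomial (∑ i ∈ a.support, Finsupp.single i 1) 1) fun e he => by
        obtain rfl := Finset.mem_singleton.1 (support_monomial_subset he)
        rw [support_sum_single]
        exact hst a ha
    have haJ := hJ a ha
    rw [faceMonomial_eq] at haJ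
    refine ⟨U, mem_of_mulBy_mem (a := ∑ i ∈ a.support, Finsupp.single i 1) haJ
      (fun e he _ => Finset.mem_singleton.1 (support_monomial_subset he)) (by simp) ?_ hU, hU⟩
    rw [support_sum_single, Finset.union_self]
    exact K.closedStar_subset_closedStar_union (hst a ha)
  choose! U hUJ hU using hex
  have hsum : T = ∑ a ∈ p.support, diffOps.mulBy k
      (K.toFaceRing (monomial (a - ∑ i ∈ a.support, Finsupp.single i 1) (p.coeff a))) * U a := by
    refine Subtype.ext (LinearMap.ext fun q => ?_)
    obtain ⟨q, rfl⟩ := K.toFaceRing_surjective q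
    rw [hT, mulHasse_apply]
    conv_lhs => rw [p.as_sum, Finset.sum_mul, map_sum]
    rw [AddSubmonoidClass.coe_finsetSum, LinearMap.sum_apply]
    refine Finset.sum_congr rfl fun a ha => ?_
    change _ = K.toFaceRing _ * (U a).1 (K.toFaceRing q)
    rw [hU a ha, ← map_mul, mulHasse_apply, ← mul_assoc, ← monomial_eq_mul_monomial_support]
  rw [hsum]
  exact sum_mem fun a ha => J.mul_mem_left _ _ (hUJ a ha)

/-- If `st σ = K`, then every `∂^(b)` with `supp b ⊆ σ` acts on the face ring, and the combination
of the products `∂^(i) x_σ ∂^(j)` that inverts the Leibniz rule is `∏ i ∈ σ, ∂ᵢ` applied to `x_σ`,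
which is `1`. -/
theorem span_faceMonomial_eq_top {σ : Finset V} (hσ : K.closedStar σ = K.faces) :
    TwoSidedIdeal.span {diffOps.mulBy k (K.faceMonomial k σ)} = ⊤ := by
  rw [← TwoSidedIdeal.one_mem_iff, faceMonomial_eq]
  have h := TwoSidedIdeal.subset_span (Set.mem_singleton
    (diffOps.mulBy k (K.toFaceRing (monomial (∑ i ∈ σ, Finsupp.single i 1) (1 : k)))))
  refine mem_of_mulBy_mem (a := ∑ i ∈ σ, Finsupp.single i 1) (b := 0) (c := 0) h
    (fun e he _ => Finset.mem_singleton.1 (support_monomial_subset he)) ?_ ?_ (fun q => ?_)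
  · simp
  · rw [support_sum_single, Finsupp.support_zero, Finset.union_empty, Finset.union_empty, hσ]
    exact fun τ hτ => hτ.1
  · rw [mulHasse_apply, hasse_zero, ← C_apply, C_1, one_mul]
    rfl

/-! ### Leading coefficients of differential operators -/

/-- The iterated commutator of `p ∂^(b)` along `s` is `p ∂^(b - s)`, or `0` unless `s ≤ b`. -/
theorem iterAd_induces {p : MvPolynomial V k} {b : V →₀ ℕ} {T : diffOps k (K.FaceRing k)}
    (hT : K.Induces (mulHasse p b) T.1) (s : Multiset V) :
    K.Induces (if Multiset.toFinsupp s ≤ b then mulHasse p (b - Multiset.toFinsupp s) else 0)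
      (iterAd k K s T).1 := by
  have h0 : K.Induces 0 (0 : Module.End k (K.FaceRing k)) := fun p => by simp
  induction s using Multiset.induction_on with
  | empty =>
    rw [map_zero, if_pos (zero_le : 0 ≤ b), tsub_zero]
    exact hT
  | cons i s ih =>
    have hs : Multiset.toFinsupp (i ::ₘ s) = Multiset.toFinsupp s + Finsupp.single i 1 := by
      rw [← Multiset.singleton_add, map_add, Multiset.toFinsupp_singleton, add_comm]
    rw [iterAd_cons, hs, ad_apply_coe]
    by_cases hle : Multiset.toFinsupp s ≤ b
    · rw [if_pos hle] at ih
      have h := ih.commutator i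
      rw [tsub_tsub] at h
      have hiff : (b - Multiset.toFinsupp s) i = 0 ↔
          ¬ Multiset.toFinsupp s + Finsupp.single i 1 ≤ b := by
        rw [← le_tsub_iff_left hle, Finsupp.single_le_iff, Nat.one_le_iff_ne_zero, not_not]
      simpa only [hiff, ite_not] using h
    · rw [if_neg hle] at ih
      rw [ih.unique h0, if_neg fun h => hle (le_self_add.trans h), zero_mul, mul_zero, sub_zero]
      exact h0

/-- On operators `p ∂^(b)` the iterated commutators of order `|b|` read off the coefficient. -/
theorem iterAd_eq_of_card_eq {p : MvPolynomial V k} {s t : Multiset V}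
    (hst : s.card = t.card) {T : diffOps k (K.FaceRing k)}
    (hT : K.Induces (mulHasse p (Multiset.toFinsupp t)) T.1) :
    iterAd k K s T = if s = t then diffOps.mulBy k (K.toFaceRing p) else 0 := by
  have h := iterAd_induces hT s
  have hle : Multiset.toFinsupp s ≤ Multiset.toFinsupp t ↔ s = t := by
    rw [← Finsupp.coe_orderIsoMultiset_symm, OrderIso.le_iff_le]
    exact ⟨fun h => Multiset.eq_of_le_of_card_le h hst.ge, fun h => h.le⟩
  split_ifs with heq
  · rw [if_pos (hle.2 heq), heq, tsub_self, ← heq] at h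
    exact Subtype.ext (h.unique (induces_mulBy p))
  · rw [if_neg (mt hle.1 heq)] at h
    exact Subtype.ext (h.unique fun p => by simp)

/-- The coefficients of a differential operator satisfy the star condition.  For a facet `F`, the
annihilator of `x_F` is stable under differential operators and contains `xᵢ` for `i ∉ F`, so it
contains the value at `1` of every commutator with `xᵢ`; but it contains no polynomial that has
a monomial supported on `F`. -/
theorem closedStar_subset_of_iterAd_eq {T : diffOps k (K.FaceRing k)} {s : Multiset V}
    {p : MvPolynomial V k} (h : iterAd k K s T = diffOps.mulBy k (K.toFaceRing p))
    {a : V →₀ ℕ} (ha : a ∈ p.support) :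
    K.closedStar a.support ⊆ K.closedStar (Multiset.toFinsupp s).support := by
  refine K.closedStar_subset_of_forall_maximal fun F hF haF i his => ?_
  by_contra hiF
  rw [Multiset.toFinsupp_support, Multiset.mem_toFinset] at his
  obtain ⟨s, rfl⟩ := Multiset.exists_cons_of_mem his
  rw [iterAd_cons] at h
  set ψ := iterAd k K s T
  have h1 : ψ.1 (K.toFaceRing (X i : MvPolynomial V k)) -
      K.toFaceRing (X i : MvPolynomial V k) * ψ.1 1 = K.toFaceRing p := by
    have := LinearMap.congr_fun (congr_arg Subtype.val h) 1
    rw [ad_apply_coe] at this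
    simpa [diffOps.mulBy, DiffOp.lmul_apply] using this
  have hXi : K.faceMonomial k F * K.toFaceRing (X i : MvPolynomial V k) = 0 := by
    rw [faceMonomial_eq, X, ← map_mul, monomial_mul, toFaceRing_eq_zero_iff]
    refine K.monomial_mem_faceIdeal (fun hK => hiF ?_) _
    refine hF.le_of_ge hK (fun j hj => ?_) ?_
    · rw [← support_sum_single F] at hj
      exact Finsupp.support_mono le_self_add hj
    · simp
  obtain ⟨N, hN⟩ := ψ.2
  have h2 := DiffOp.mul_apply_eq_zero (faceMonomial_mul_eq_zero_of_sq F) hN hXi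
  have h3 : K.faceMonomial k F * K.toFaceRing p = 0 := by
    rw [← h1, mul_sub, h2, ← mul_assoc, hXi, zero_mul, sub_zero]
  rw [faceMonomial_eq, ← map_mul, toFaceRing_eq_zero_iff, mem_faceIdeal_iff] at h3
  refine h3 _ ((add_mem_support_monomial_mul _ _ _).2 ha) (K.down_closed hF.prop fun j hj => ?_)
  rcases Finset.mem_union.1 (Finsupp.support_add hj) with hj | hj
  · rwa [support_sum_single] at hj
  · exact haF hj

/-- An ideal contained in `I` and containing all the `x_σ` of `I` is `I`.  If all commutators of
length `N + 1` of an element of `I` vanish, then those of length `N` are multiplications by elements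
of `I`, and subtracting the operators `p ∂^(b)` with these leading coefficients lowers the order. -/
theorem mem_of_forall_faceMonomial_mem (hk : IsField k)
    {I J : TwoSidedIdeal (diffOps k (K.FaceRing k))} (hJI : J ≤ I)
    (hIJ : ∀ σ, diffOps.mulBy k (K.faceMonomial k σ) ∈ I →
      diffOps.mulBy k (K.faceMonomial k σ) ∈ J) (N : ℕ) :
    ∀ T ∈ I, (∀ s : Multiset V, s.card = N → iterAd k K s T = 0) → T ∈ J := by
  induction N with
  | zero =>
    intro T _ h
    have : T = 0 := h 0 rfl
    rw [this]
    exact J.zero_mem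
  | succ N ih =>
    intro T hT h
    -- The commutators of length `N` commute with all variables, so they are multiplications.
    have hex : ∀ t : Sym V N, ∃ p : MvPolynomial V k,
        iterAd k K t T = diffOps.mulBy k (K.toFaceRing p) := fun t => by
      obtain ⟨p, hp⟩ := K.toFaceRing_surjective ((iterAd k K t T).1 1)
      refine ⟨p, Subtype.ext ?_⟩
      rw [hp]
      refine DiffOp.eq_lmul_of_commute K.toFaceRing_surjective fun i => ?_
      rw [← sub_eq_zero, ← ad_apply_coe, ← iterAd_cons, h _ (by simp)]
      rfl
    choose p hp using hex
    have hst (t : Sym V N) : ∀ a ∈ (p t).support,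
        K.closedStar a.support ⊆ K.closedStar (Multiset.toFinsupp (t : Multiset V)).support :=
      fun a ha => closedStar_subset_of_iterAd_eq (hp t) ha
    choose U hU using fun t => exists_diffOps_induces (hst t)
    have hUJ (t : Sym V N) : U t ∈ J :=
      mem_of_induces_mulHasse (fun a ha => hIJ _ (mulBy_faceMonomial_mem hk I (p t)
        (hp t ▸ iterAd_mem hT _) a ha)) (hst t) (hU t)
    have hsum : ∑ t, U t ∈ J := sum_mem fun t _ => hUJ t
    rw [← sub_add_cancel T (∑ t, U t)]
    refine J.add_mem (ih _ (I.sub_mem hT (hJI hsum)) fun s hs => ?_) hsum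
    obtain ⟨t, rfl⟩ : ∃ t : Sym V N, s = t := ⟨⟨s, hs⟩, rfl⟩
    rw [map_sub, map_sum, Finset.sum_eq_single t, iterAd_eq_of_card_eq rfl (hU t), if_pos rfl,
      ← hp, sub_self]
    · intro u _ hut
      rw [iterAd_eq_of_card_eq (s := (t : Multiset V)) (t.2.trans u.2.symm) (hU u), if_neg]
      exact fun h => hut (Subtype.ext h.symm)
    · exact fun h => absurd (Finset.mem_univ _) h

end SimplicialCpx

theorem mainTheorem2 {k : Type*} [CommRing k] [IsDomain k] {n : ℕ} (K : SimplicialCpx (Fin n)) :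
    (IsField k →
      ∀ I : TwoSidedIdeal (diffOps k (K.FaceRing k)), I ≠ ⊤ →
        ∃ S : Set (Finset (Fin n)),
          (∀ σ ∈ S, σ ∈ K.faces ∧ K.closedStar σ ≠ K.faces) ∧
          I = TwoSidedIdeal.span ((fun σ => diffOps.mulBy k (K.faceMonomial k σ)) '' S)) ∧
    (∀ σ ∈ K.faces, K.closedStar σ = K.faces →
      TwoSidedIdeal.span {diffOps.mulBy k (K.faceMonomial k σ)} = ⊤) := by
  refine ⟨fun hk I hI => ?_, fun σ _ hσ => SimplicialCpx.span_faceMonomial_eq_top hσ⟩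
  have hle : TwoSidedIdeal.span ((fun σ => diffOps.mulBy k (K.faceMonomial k σ)) ''
      {σ | σ ∈ K.faces ∧ diffOps.mulBy k (K.faceMonomial k σ) ∈ I}) ≤ I := by
    rw [TwoSidedIdeal.span_le]
    rintro _ ⟨σ, hσ, rfl⟩
    exact hσ.2
  refine ⟨{σ | σ ∈ K.faces ∧ diffOps.mulBy k (K.faceMonomial k σ) ∈ I},
    fun σ hσ => ⟨hσ.1, fun hst => hI ?_⟩, le_antisymm (fun T hT => ?_) hle⟩
  · rw [← top_le_iff, ← SimplicialCpx.span_faceMonomial_eq_top (k := k) hst,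
      TwoSidedIdeal.span_le, Set.singleton_subset_iff]
    exact hσ.2
  · obtain ⟨N, hN⟩ := SimplicialCpx.exists_iterAd_eq_zero T
    refine SimplicialCpx.mem_of_forall_faceMonomial_mem hk hle (fun σ hσ => ?_) N T hT hN
    by_cases hσK : σ ∈ K.faces
    · exact TwoSidedIdeal.subset_span ⟨σ, ⟨hσK, hσ⟩, rfl⟩
    · have h0 : K.faceMonomial k σ = 0 :=
        Ideal.Quotient.eq_zero_iff_mem.2 (Ideal.subset_span ⟨σ, hσK, rfl⟩)
      have h1 : diffOps.mulBy k (K.faceMonomial k σ) = 0 := by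
        rw [h0]
        exact Subtype.ext (map_zero (Algebra.lmul k _))
      rw [h1]
      exact TwoSidedIdeal.zero_mem _
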